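/- Let $\Bbbk$ be a field of characteristic zero, and let $W_+$ be the positive Witt algebra, that is, the Lie algebra over $\Bbbk$ with basis $\{e_i : i \in \mathbb{Z}_{\geq 1}\}$ and bracket $[e_i,e_j]=(j-i)e_{i+j}$. Let $\mathrm{S}(W_+)=\Bbbk[x_1,x_2,\dots]$ be its symmetric algebra, where $x_i$ is the image of $e_i$, with the Poisson bracket induced by the Lie bracket, so $\{x_i,x_j\}=(j-i)x_{i+j}$. The order $o(f)$ of a nonzero $f\in \mathrm{S}(W_+)$ is its total degree as a polynomial in the $x_i$ (so $o(x_i)=1$ for all $i$). A Poisson ideal of $\mathrm{S}(W_+)$ is an ideal $J$ with $\{\mathrm{S}(W_+),J\}\subseteq J$; then $\mathrm{S}(W_+)/J$ is a Poisson algebra. For a (commutative) Poisson $\Bbbk$-algebra $A$ and a finite-dimensional subspace $V\subseteq A$, put $V^{\{0\}}=\Bbbk$, $V^{\{n+1\}}=V V^{\{n\}}+\{V,V^{\{n\}}\}$ and $\mathrm{pd}_V(n)=\dim\bigl(\sum_{i=0}^n V^{\{i\}}\bigr)$. If $V$ generates $A$ as a Poisson algebra, the Poisson Gelfand–Kirillov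 dimension $\operatorname{PGKdim} A$ is the infimum of those real $\gamma\geq 0$ for which there are $c,m\in\mathbb{N}$ with $\mathrm{pd}_V(n)\leq c\,(mn)^\gamma$ for all but finitely many $n$ (it is $\infty$ if there is no such $\gamma$, and it does not depend on $V$); for arbitrary $A$, $\operatorname{PGKdim} A$ is the supremum of $\operatorname{PGKdim} A'$ over all finitely generated Poisson subalgebras $A'$ of $A$. Proposition. Let $J$ be a Poisson ideal of $\mathrm{S}(W_+)$ that contains a nonzero element of order at most two. Then $$\operatorname{PGKdim}\bigl(\mathrm{S}(W_+)/J\bigr)<\infty .$$ -/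

import Mathlib

open scoped NNReal ENNReal

noncomputable section

/-- A Poisson structure over `k` on a commutative `k`-algebra `A`: a `k`-bilinear Lie bracket
which is a derivation in each argument (in the first one by antisymmetry). -/
structure PoissonStructure (k A : Type*) [Field k] [CommRing A] [Algebra k A] where
  bracket : A →ₗ[k] A →ₗ[k] A
  bracket_self : ∀ a, bracket a a = 0
  jacobi : ∀ a b c,
    bracket a (bracket b c) + bracket b (bracket c a) + bracket c (bracket a b) = 0
  leibniz : ∀ a b c, bracket a (b * c) = b * bracket a c + c * bracket a b

namespace PoissonStructure

section General

variable {k A : Type*} [Field k] [CommRing A] [Algebra k A] (P : PoissonStructure k A)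

/-- Poisson ideals: ideals `I` with `{A, I} ⊆ I`. -/
def IsPoissonIdeal (I : Ideal A) : Prop :=
  ∀ a : A, ∀ b ∈ I, P.bracket a b ∈ I

/-- Poisson subalgebras: (unital) subalgebras closed under the bracket. -/
def IsPoissonSubalgebra (B : Subalgebra k A) : Prop :=
  ∀ a ∈ B, ∀ b ∈ B, P.bracket a b ∈ B

/-- The subspace `V` generates `B` as a Poisson algebra: `B` is the smallest Poisson subalgebra
that contains `V`. -/
def Generates (V : Submodule k A) (B : Subalgebra k A) : Prop :=
  IsLeast {C : Subalgebra k A | P.IsPoissonSubalgebra C ∧ (V : Set A) ⊆ C} B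

/-- The subspaces `V^{n}`: `V^{0} = k` and `V^{n+1} = V V^{n} + {V, V^{n}}`. -/
def bracePow (V : Submodule k A) : ℕ → Submodule k A
  | 0 => 1
  | n + 1 => V * bracePow V n ⊔ Submodule.map₂ P.bracket V (bracePow V n)

/-- `pd_V(n) = dim (V^{0} + ... + V^{n})`, used for finite-dimensional `V`. -/
def pd (V : Submodule k A) (n : ℕ) : ℕ :=
  Module.finrank k (⨆ i ∈ Finset.range (n + 1), P.bracePow V i : Submodule k A)

end General

end PoissonStructure

/-- `f ≤* g`: there are `c, m` with `f n ≤ c * g (m * n)` for all but finitely many `n`. -/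
def GrowthLE (f g : ℕ → ℝ) : Prop :=
  ∃ c m : ℕ, ∀ᶠ n : ℕ in Filter.atTop, f n ≤ c * g (m * n)

/-- `inf {γ ≥ 0 : f ≤* n^γ}`, which is `∞` if there is no such `γ`. -/
def growthExponent (f : ℕ → ℝ) : ℝ≥0∞ :=
  ⨅ (γ : ℝ≥0) (_ : GrowthLE f (fun n => (n : ℝ) ^ (γ : ℝ))), (γ : ℝ≥0∞)

namespace PoissonStructure

section General

variable {k A : Type*} [Field k] [CommRing A] [Algebra k A] (P : PoissonStructure k A)

/-- The Poisson Gelfand-Kirillov dimension: the supremum, over the Poisson subalgebras `B` that are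
generated by a finite-dimensional subspace `V`, of the growth exponent of `pd_V`. The latter depends
only on `B`, and `pd_V` is the same whether computed in `B` or in `A`. -/
def pgkDim : ℝ≥0∞ :=
  ⨆ (B : Subalgebra k A) (V : Submodule k A) (_ : FiniteDimensional k V) (_ : P.Generates V B),
    growthExponent (fun n => (P.pd V n : ℝ))

theorem neg_bracket (a b : A) : -P.bracket a b = P.bracket b a := by
  have h := P.bracket_self (a + b)
  simp only [map_add, LinearMap.add_apply, P.bracket_self, zero_add, add_zero] at h
  exact neg_eq_of_add_eq_zero_left h

/-- The induced Poisson structure on the quotient by a Poisson ideal. -/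
def quotient (I : Ideal A) (hI : P.IsPoissonIdeal I) : PoissonStructure k (A ⧸ I) where
  bracket := LinearMap.mk₂ k
    (Quotient.map₂ (fun a b => P.bracket a b) (by
      intro a a' ha b b' hb
      have ha' : a - a' ∈ I := (Submodule.quotientRel_def I).1 ha
      have hb' : b - b' ∈ I := (Submodule.quotientRel_def I).1 hb
      refine (Submodule.quotientRel_def I).2 ?_
      have h : P.bracket a b - P.bracket a' b'
          = P.bracket a (b - b') - P.bracket b' (a - a') := by
        rw [← P.neg_bracket (a - a') b']
        simp only [map_sub, LinearMap.sub_apply]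
        ring
      rw [h]
      exact I.sub_mem (hI _ _ hb') (hI _ _ ha')))
    (by
      rintro ⟨a⟩ ⟨b⟩ ⟨c⟩
      exact congrArg (Ideal.Quotient.mk I) (by simp : P.bracket (a + b) c = _))
    (by
      rintro r ⟨a⟩ ⟨b⟩
      exact congrArg (Ideal.Quotient.mk I) (by simp : P.bracket (r • a) b = r • _))
    (by
      rintro ⟨a⟩ ⟨b⟩ ⟨c⟩
      exact congrArg (Ideal.Quotient.mk I) (by simp : P.bracket a (b + c) = _))
    (by
      rintro r ⟨a⟩ ⟨b⟩
      exact congrArg (Ideal.Quotient.mk I) (by simp : P.bracket a (r • b) = r • _))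
  bracket_self := by
    rintro ⟨a⟩
    exact congrArg (Ideal.Quotient.mk I) (P.bracket_self a)
  jacobi := by
    rintro ⟨a⟩ ⟨b⟩ ⟨c⟩
    exact congrArg (Ideal.Quotient.mk I) (P.jacobi a b c)
  leibniz := by
    rintro ⟨a⟩ ⟨b⟩ ⟨c⟩
    exact congrArg (Ideal.Quotient.mk I) (P.leibniz a b c)

theorem quotient_bracket_mk (I : Ideal A) (hI : P.IsPoissonIdeal I) (a b : A) :
    (P.quotient I hI).bracket (Ideal.Quotient.mk I a) (Ideal.Quotient.mk I b)
      = Ideal.Quotient.mk I (P.bracket a b) :=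
  rfl

end General

end PoissonStructure

/-- The symmetric algebra `S(W_+)` of the positive Witt algebra `W_+` (the Lie algebra with basis
`e_i`, `i ≥ 1`, and bracket `[e_i, e_j] = (j - i) e_{i+j}`): the polynomial ring `k[x_1, x_2, ...]`,
where `x_i` is the image of `e_i`. -/
abbrev SymWitt (k : Type*) [Field k] : Type _ := MvPolynomial ℕ+ k

namespace SymWitt

open MvPolynomial

section Bracket

variable (k : Type*) [Field k]

/-- The derivation `{x_i, -}` of `S(W_+)`, with `{x_i, x_j} = (j - i) x_{i+j}`. -/
def adX (i : ℕ+) : Derivation k (SymWitt k) (SymWitt k) :=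
  mkDerivation k fun j => (((j : ℕ) : k) - ((i : ℕ) : k)) • X (i + j)

/-- The derivation `{-, g}` of `S(W_+)`, with `x_i ↦ {x_i, g}`. -/
def bracketRight (g : SymWitt k) : Derivation k (SymWitt k) (SymWitt k) :=
  mkDerivation k fun i => adX k i g

/-- The bracket of `S(W_+)`: the biderivation with `{x_i, x_j} = (j - i) x_{i+j}`. -/
def bracket : SymWitt k →ₗ[k] SymWitt k →ₗ[k] SymWitt k :=
  LinearMap.mk₂ k (fun f g => bracketRight k g f)
    (fun f f' g => map_add _ f f')
    (fun r f g => Derivation.map_smul _ r f)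
    (fun f g g' => by
      have h : bracketRight k (g + g') = bracketRight k g + bracketRight k g' :=
        derivation_ext fun i => by simp [bracketRight, mkDerivation_X]
      rw [h, Derivation.add_apply])
    (fun r f g => by
      have h : bracketRight k (r • g) = r • bracketRight k g :=
        derivation_ext fun i => by simp [bracketRight, mkDerivation_X]
      rw [h, Derivation.smul_apply])

variable {k}

theorem bracket_X_left (i : ℕ+) (g : SymWitt k) : bracket k (X i) g = adX k i g := by
  simp [bracket, bracketRight, mkDerivation_X]

theorem bracket_X_X (i j : ℕ+) :
    bracket k (X i) (X j) = (((j : ℕ) : k) - ((i : ℕ) : k)) • X (i + j) := by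
  simp [bracket_X_left, adX, mkDerivation_X]

theorem bracket_mul_left (a b g : SymWitt k) :
    bracket k (a * b) g = a * bracket k b g + b * bracket k a g := by
  simp [bracket]

theorem bracket_C_left (r : k) (g : SymWitt k) : bracket k (C r) g = 0 := by
  simp [bracket]

theorem bracket_antisymm (f g : SymWitt k) : bracket k f g = -bracket k g f := by
  have hX : ∀ (i : ℕ+) (g : SymWitt k), bracket k (X i) g = -bracket k g (X i) := by
    intro i g
    rw [bracket_X_left]
    have h : adX k i = -bracketRight k (X i) := derivation_ext fun j => by
      have h1 := bracket_X_X (k := k) i j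
      have h2 := bracket_X_X (k := k) j i
      rw [bracket_X_left] at h1
      have h3 : bracketRight k (X i) (X j) = bracket k (X j) (X i) := rfl
      rw [Derivation.neg_apply, h3, h1, h2, add_comm j i, ← neg_smul, neg_sub]
    rw [h]
    rfl
  have key : ∀ a b : SymWitt k, bracket k g (a * b)
      = a * bracket k g b + b * bracket k g a := by
    intro a b
    induction g using MvPolynomial.induction_on with
    | C r => simp [bracket_C_left]
    | add p q hp hq => simp only [map_add, LinearMap.add_apply, hp, hq]; ring
    | mul_X p n hp =>
      simp only [bracket_mul_left, hp, bracket_X_left, Derivation.leibniz, smul_eq_mul]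
      ring
  induction f using MvPolynomial.induction_on with
  | C r =>
    rw [bracket_C_left, ← mul_one (C r), ← smul_eq_C_mul, map_smul]
    have h1 : bracket k g 1 = 0 := by simpa using key 1 1
    simp [h1]
  | add p q hp hq => simp only [map_add, LinearMap.add_apply, hp, hq]; ring
  | mul_X p n hp => rw [bracket_mul_left, key, hp, hX]; ring

theorem bracket_mul_right (g a b : SymWitt k) :
    bracket k g (a * b) = a * bracket k g b + b * bracket k g a := by
  rw [bracket_antisymm, bracket_mul_left, bracket_antisymm a g, bracket_antisymm b g]
  ring

theorem bracket_C_right (g : SymWitt k) (r : k) : bracket k g (C r) = 0 := by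
  rw [bracket_antisymm, bracket_C_left, neg_zero]

theorem bracket_self (f : SymWitt k) : bracket k f f = 0 := by
  induction f using MvPolynomial.induction_on with
  | C r => exact bracket_C_left r _
  | add p q hp hq =>
    simp only [map_add, LinearMap.add_apply, hp, hq]
    rw [bracket_antisymm p q]
    ring
  | mul_X p n hp =>
    have hn : bracket k (X n) (X n) = (0 : SymWitt k) := by rw [bracket_X_X]; simp
    simp only [bracket_mul_left, bracket_mul_right, hp, hn]
    rw [bracket_antisymm p (X n)]
    ring

theorem jacobi_step (b c p q : SymWitt k)
    (hp : bracket k p (bracket k b c) + bracket k b (bracket k c p)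
      + bracket k c (bracket k p b) = 0)
    (hq : bracket k q (bracket k b c) + bracket k b (bracket k c q)
      + bracket k c (bracket k q b) = 0) :
    bracket k (p * q) (bracket k b c) + bracket k b (bracket k c (p * q))
      + bracket k c (bracket k (p * q) b) = 0 := by
  simp only [bracket_mul_left, bracket_mul_right, map_add]
  rw [bracket_antisymm p b, bracket_antisymm q b] at *
  simp only [map_neg] at *
  linear_combination p * hq + q * hp

theorem jacobi_ext (b c : SymWitt k)
    (h : ∀ i : ℕ+, bracket k (X i) (bracket k b c) + bracket k b (bracket k c (X i))
      + bracket k c (bracket k (X i) b) = 0) (a : SymWitt k) :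
    bracket k a (bracket k b c) + bracket k b (bracket k c a)
      + bracket k c (bracket k a b) = 0 := by
  induction a using MvPolynomial.induction_on with
  | C r => simp [bracket_C_left, bracket_C_right]
  | add p q hp hq =>
    simp only [map_add, LinearMap.add_apply]
    linear_combination hp + hq
  | mul_X p n hp => exact jacobi_step b c p (X n) hp (h n)

theorem bracket_jacobi (a b c : SymWitt k) :
    bracket k a (bracket k b c) + bracket k b (bracket k c a)
      + bracket k c (bracket k a b) = 0 := by
  refine jacobi_ext b c (fun i => ?_) a
  have h1 := jacobi_ext c (X i) (fun j => ?_) b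
  · linear_combination h1
  have h2 := jacobi_ext (X i) (X j) (fun l => ?_) c
  · linear_combination h2
  simp only [bracket_X_X, map_smul, smul_smul]
  rw [show j + (l + i) = l + (i + j) by ac_rfl,
    show i + (j + l) = l + (i + j) by ac_rfl, ← add_smul, ← add_smul]
  convert zero_smul k _
  push_cast
  ring

variable (k)

/-- The Poisson structure of `S(W_+)` induced by the Lie bracket of `W_+`. -/
def poisson : PoissonStructure k (SymWitt k) where
  bracket := bracket k
  bracket_self := bracket_self
  jacobi := bracket_jacobi
  leibniz := bracket_mul_right

end Bracket

/-- The order of an element of `S(W_+)`: its degree for the grading with `o(x_i) = 1`. -/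
def order {k : Type*} [Field k] (f : SymWitt k) : ℕ := f.totalDegree

end SymWitt

end

/-!
Multiplying by a power of `x_1`, we may assume that the Poisson ideal `J` contains some `f` of
order exactly two. Let `∂ⱼ∂ᵢf(0) ≠ 0` with `i + j` as large as possible and, among these, `j` as
large as possible. For `a` and `b` large, the quadratic part of `{x_a, {x_b, f}} ∈ J` contains
`x_{a+j} x_{b+i}` with the coefficient `(i - b) (j - a) ∂ⱼ∂ᵢf(0) ≠ 0`, and its other monomials
`x_u x_v` have a smaller `u + v`, or the same `u + v` and a smaller `u`. Hence modulo `J` every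
product of two variables of large index can be rewritten until at most one factor is large.

Give `x_i` the weight `i + C`. If `C` is large, the linear terms of `{x_a, {x_b, f}}` do not raise
the weight either, and the polynomials of weight at most `n` form a filtration compatible with the
product and the bracket. In the quotient, its `n`-th step is spanned by the monomials of weight at
most `n` with at most one factor outside a fixed finite set of variables, and their number is
polynomial in `n`. A Poisson algebra with such a filtration has finite Poisson Gelfand-Kirillov
dimension.
-/

section WeightFiltration

open MvPolynomial

variable {σ R M : Type*} [CommSemiring R] [AddCommMonoid M] [PartialOrder M]

variable (R) in
/-- The polynomials all of whose monomials have weight at most `n`, where the variable `i` has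
weight `w i`. -/
noncomputable def weightLE (w : σ → M) (n : M) : Submodule R (MvPolynomial σ R) :=
  restrictSupport R {α | Finsupp.weight w α ≤ n}

theorem monomial_mem_weightLE {w : σ → M} {n : M} {α : σ →₀ ℕ} (h : Finsupp.weight w α ≤ n)
    (r : R) : monomial α r ∈ weightLE R w n :=
  (monomial_mem_restrictSupport R).2 (Or.inl h)

theorem X_mem_weightLE {w : σ → M} {n : M} {i : σ} (h : w i ≤ n) : X i ∈ weightLE R w n :=
  monomial_mem_weightLE (by rwa [Finsupp.weight_single, one_smul]) 1

theorem weightLE_mono (w : σ → M) : Monotone (weightLE R w) := fun _ _ h =>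
  restrictSupport_mono R fun _ hα => le_trans hα h

theorem exists_mem_weightLE {M : Type*} [AddCommMonoid M] [SemilatticeSup M] [OrderBot M]
    (w : σ → M) (p : MvPolynomial σ R) : ∃ n, p ∈ weightLE R w n :=
  ⟨p.support.sup (Finsupp.weight w), (mem_restrictSupport_iff R).2 fun _ hα => Finset.le_sup hα⟩

variable [IsOrderedAddMonoid M]

theorem mul_mem_weightLE {w : σ → M} {m n : M} {p q : MvPolynomial σ R}
    (hp : p ∈ weightLE R w m) (hq : q ∈ weightLE R w n) : p * q ∈ weightLE R w (m + n) := by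
  have hpq := Submodule.mul_mem_mul hp hq
  rw [weightLE, weightLE, ← restrictSupport_add] at hpq
  refine restrictSupport_mono R ?_ hpq
  rintro _ ⟨α, hα, β, hβ, rfl⟩
  exact (map_add (Finsupp.weight w) α β).trans_le (add_le_add hα hβ)

theorem derivation_mem_weightLE {w : σ → M} {d n : M}
    {D : Derivation R (MvPolynomial σ R) (MvPolynomial σ R)}
    (hD : ∀ i, D (X i) ∈ weightLE R w (w i + d)) {p : MvPolynomial σ R}
    (hp : p ∈ weightLE R w n) : D p ∈ weightLE R w (n + d) := by
  rw [show D = mkDerivation R fun i => D (X i) from derivation_ext fun i => by simp, p.as_sum,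
    map_sum]
  refine Submodule.sum_mem _ fun α hα => ?_
  rw [mkDerivation_monomial]
  refine Submodule.smul_mem _ _ (Submodule.sum_mem _ fun i hi => ?_)
  refine weightLE_mono w (add_le_add_left (hp hα) d) ?_
  rw [← Finsupp.weight_sub_single_add (Finsupp.mem_support_iff.1 hi), add_assoc]
  exact mul_mem_weightLE (monomial_mem_weightLE le_rfl _) (hD i)

end WeightFiltration

section OuterWeight

variable {σ : Type*}

theorem eq_zero_or_single_of_degree_le_one {α : σ →₀ ℕ} (hα : α.degree ≤ 1) :
    α = 0 ∨ ∃ i, Finsupp.single i 1 = α := by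
  rcases Nat.le_one_iff_eq_zero_or_eq_one.1 hα with h₀ | h₁
  · exact Or.inl ((Finsupp.degree_eq_zero_iff α).1 h₀)
  · exact Or.inr (Finsupp.range_single_one.ge h₁)

theorem eq_of_degree_le_one_of_weight_eq {w : σ → ℕ} (hw : Function.Injective w)
    (hw₀ : ∀ i, w i ≠ 0) {α β : σ →₀ ℕ} (hα : α.degree ≤ 1) (hβ : β.degree ≤ 1)
    (h : Finsupp.weight w α = Finsupp.weight w β) : α = β := by
  rcases eq_zero_or_single_of_degree_le_one hα with rfl | ⟨i, rfl⟩ <;>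
    rcases eq_zero_or_single_of_degree_le_one hβ with rfl | ⟨j, rfl⟩
  · rfl
  · simp [Finsupp.weight_single, (hw₀ j).symm] at h
  · simp [Finsupp.weight_single, hw₀ i] at h
  · rw [hw (by simpa [Finsupp.weight_single] using h : w i = w j)]

variable [DecidableEq σ] {s : Finset σ}

/-- The weight for which the weight of a monomial is its degree in the variables outside `s`. -/
def outerWeight (s : Finset σ) (i : σ) : ℕ := if i ∈ s then 0 else 1

theorem outerWeight_of_mem {i : σ} (hi : i ∈ s) : outerWeight s i = 0 := if_pos hi

theorem outerWeight_of_notMem {i : σ} (hi : i ∉ s) : outerWeight s i = 1 := if_neg hi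

theorem outerWeight_le_one (s : Finset σ) (i : σ) : outerWeight s i ≤ 1 := by
  unfold outerWeight
  split_ifs <;> decide

theorem degree_filter_notMem (s : Finset σ) (α : σ →₀ ℕ) :
    (α.filter (· ∉ s)).degree = Finsupp.weight (outerWeight s) α := by
  rw [Finsupp.degree_apply, Finsupp.support_filter, Finset.sum_filter, Finsupp.weight_apply]
  refine Finset.sum_congr rfl fun i _ => ?_
  by_cases hi : i ∈ s <;> simp [outerWeight, hi]

theorem exists_eq_add_single_of_weight_outerWeight_eq_succ {α : σ →₀ ℕ} {r : ℕ}
    (h : Finsupp.weight (outerWeight s) α = r + 1) :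
    ∃ (β : σ →₀ ℕ) (i : σ), i ∉ s ∧ α = β + Finsupp.single i 1 ∧
      Finsupp.weight (outerWeight s) β = r := by
  have hsum : ∑ i ∈ α.support, α i • outerWeight s i ≠ 0 := by
    rw [Finsupp.weight_apply] at h
    exact h.trans_ne r.succ_ne_zero
  obtain ⟨i, hi, hwi⟩ := Finset.exists_ne_zero_of_sum_ne_zero hsum
  have his : i ∉ s := fun his => right_ne_zero_of_smul hwi (outerWeight_of_mem his)
  refine ⟨α - Finsupp.single i 1, i, his,
    (Finsupp.sub_add_single_one_cancel (Finsupp.mem_support_iff.1 hi)).symm, ?_⟩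
  have := Finsupp.weight_sub_single_add (w := outerWeight s) (Finsupp.mem_support_iff.1 hi)
  rw [outerWeight_of_notMem his, h] at this
  exact Nat.succ_injective this

/-- A monomial with at most one variable outside `s` is determined by its exponents in `s` and the
weight of the remaining variable. -/
theorem mk_weight_le_outerWeight_le_one {w : σ → ℕ} (hw : Function.Injective w)
    (hw₀ : ∀ i, w i ≠ 0) (s : Finset σ) (n : ℕ) :
    Cardinal.mk {α : σ →₀ ℕ | Finsupp.weight w α ≤ n ∧ Finsupp.weight (outerWeight s) α ≤ 1}
      ≤ ((n + 1) ^ (s.card + 1) : ℕ) := by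
  set T := {α : σ →₀ ℕ | Finsupp.weight w α ≤ n ∧ Finsupp.weight (outerWeight s) α ≤ 1}
  have hexp (α : T) (i : σ) : α.1 i < n + 1 :=
    Nat.lt_succ_of_le ((Finsupp.le_weight w (hw₀ i) α.1).trans α.2.1)
  have houter (α : T) : Finsupp.weight w (α.1.filter (· ∉ s)) < n + 1 := by
    refine Nat.lt_succ_of_le (le_trans ?_ α.2.1)
    conv_rhs => rw [← Finsupp.filter_add_filter_not α.1 (· ∈ s), map_add]
    exact Nat.le_add_left _ _
  let code (α : T) : (s → Fin (n + 1)) × Fin (n + 1) := (fun i => ⟨α.1 i, hexp α i⟩, ⟨_, houter α⟩)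
  have hcode : Function.Injective code := by
    intro α β h
    obtain ⟨hin, hout⟩ := Prod.mk.inj h
    have hfilter : α.1.filter (· ∉ s) = β.1.filter (· ∉ s) :=
      eq_of_degree_le_one_of_weight_eq hw hw₀ ((degree_filter_notMem s α.1).trans_le α.2.2)
        ((degree_filter_notMem s β.1).trans_le β.2.2) (Fin.mk.inj hout)
    ext i
    by_cases hi : i ∈ s
    · exact Fin.mk.inj (congrFun hin ⟨i, hi⟩)
    · simpa [hi] using DFunLike.congr_fun hfilter i
  exact (Cardinal.mk_le_of_injective hcode).trans_eq (by simp [pow_succ])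

end OuterWeight

section BoundedOutside

open MvPolynomial

variable {σ : Type*} [DecidableEq σ] (R : Type*) [CommSemiring R]

/-- The polynomials all of whose monomials have weight at most `n` and degree at most `r` in the
variables outside `s`. -/
noncomputable def boundedOutside (w : σ → ℕ) (s : Finset σ) (n r : ℕ) :
    Submodule R (MvPolynomial σ R) :=
  weightLE R w n ⊓ weightLE R (outerWeight s) r

theorem rank_boundedOutside_one_le [Nontrivial R] {w : σ → ℕ} (hw : Function.Injective w)
    (hw₀ : ∀ i, w i ≠ 0) (s : Finset σ) (n : ℕ) :
    Module.rank R (boundedOutside R w s n 1) ≤ ((n + 1) ^ (s.card + 1) : ℕ) := by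
  have hle : boundedOutside R w s n 1 ≤ restrictSupport R
      {α | Finsupp.weight w α ≤ n ∧ Finsupp.weight (outerWeight s) α ≤ 1} :=
    fun p ⟨hn, h₁⟩ α hα => ⟨hn hα, h₁ hα⟩
  refine (Submodule.rank_mono hle).trans (Cardinal.lift_le_nat_iff.1 ?_)
  rw [← (basisRestrictSupport R _).mk_eq_rank]
  exact Cardinal.lift_le_nat_iff.2 (mk_weight_le_outerWeight_le_one hw hw₀ s n)

variable {R}

theorem boundedOutside_mono (w : σ → ℕ) (s : Finset σ) {m n q r : ℕ} (hmn : m ≤ n)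
    (hqr : q ≤ r) : boundedOutside R w s m q ≤ boundedOutside R w s n r :=
  inf_le_inf (weightLE_mono w hmn) (weightLE_mono _ hqr)

theorem mul_mem_boundedOutside {w : σ → ℕ} {s : Finset σ} {m n q r : ℕ} {f g : MvPolynomial σ R}
    (hf : f ∈ boundedOutside R w s m q) (hg : g ∈ boundedOutside R w s n r) :
    f * g ∈ boundedOutside R w s (m + n) (q + r) :=
  ⟨mul_mem_weightLE hf.1 hg.1, mul_mem_weightLE hf.2 hg.2⟩

theorem X_mem_boundedOutside_one (w : σ → ℕ) (s : Finset σ) (i : σ) :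
    (X i : MvPolynomial σ R) ∈ boundedOutside R w s (w i) 1 :=
  ⟨X_mem_weightLE le_rfl, X_mem_weightLE (outerWeight_le_one s i)⟩

theorem X_mul_X_mem_boundedOutside_one (w : σ → ℕ) {s : Finset σ} {i j : σ}
    (h : i ∈ s ∨ j ∈ s) :
    (X i * X j : MvPolynomial σ R) ∈ boundedOutside R w s (w i + w j) 1 := by
  have of_left {i j : σ} (hi : i ∈ s) :
      (X i * X j : MvPolynomial σ R) ∈ boundedOutside R w s (w i + w j) 1 := by
    have hXi : (X i : MvPolynomial σ R) ∈ boundedOutside R w s (w i) 0 :=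
      ⟨X_mem_weightLE le_rfl, X_mem_weightLE (outerWeight_of_mem hi).le⟩
    simpa only [zero_add] using mul_mem_boundedOutside hXi (X_mem_boundedOutside_one w s j)
  rcases h with hi | hj
  · exact of_left hi
  · rw [mul_comm, add_comm]
    exact of_left hj

variable {w : σ → ℕ} {s : Finset σ} {I : Ideal (MvPolynomial σ R)}

theorem mul_mem_boundedOutside_sup {m n q r : ℕ} {f g : MvPolynomial σ R}
    (hf : f ∈ boundedOutside R w s m q)
    (hg : g ∈ boundedOutside R w s n r ⊔ I.restrictScalars R) :
    f * g ∈ boundedOutside R w s (m + n) (q + r) ⊔ I.restrictScalars R := by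
  obtain ⟨b, hb, c, hc, rfl⟩ := Submodule.mem_sup.1 hg
  rw [mul_add]
  exact Submodule.add_mem_sup (mul_mem_boundedOutside hf hb) (I.mul_mem_left f hc)

theorem mem_boundedOutside_sup_of_le {m n r : ℕ} {f : MvPolynomial σ R} (hmn : m ≤ n)
    (hf : f ∈ boundedOutside R w s m r ⊔ I.restrictScalars R) :
    f ∈ boundedOutside R w s n r ⊔ I.restrictScalars R :=
  (sup_le_sup_right (boundedOutside_mono w s hmn le_rfl) (I.restrictScalars R) :) hf

theorem boundedOutside_add_two_le_sup
    (hI : ∀ i ∉ s, ∀ j ∉ s,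
      X i * X j ∈ boundedOutside R w s (w i + w j) 1 ⊔ I.restrictScalars R) (n r : ℕ) :
    boundedOutside R w s n (r + 2) ≤ boundedOutside R w s n (r + 1) ⊔ I.restrictScalars R := by
  rintro p ⟨hn, hr⟩
  rw [p.as_sum]
  refine Submodule.sum_mem _ fun α hα => ?_
  have hαn : Finsupp.weight w α ≤ n := hn hα
  rcases (show Finsupp.weight (outerWeight s) α ≤ r + 2 from hr hα).lt_or_eq with hlt | heq
  · exact Submodule.mem_sup_left
      ⟨monomial_mem_weightLE hαn _, monomial_mem_weightLE (Nat.lt_succ_iff.1 hlt) _⟩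
  generalize p.coeff α = c
  obtain ⟨γ, i, hi, rfl, hγ⟩ := exists_eq_add_single_of_weight_outerWeight_eq_succ heq
  obtain ⟨β, j, hj, rfl, hβ⟩ := exists_eq_add_single_of_weight_outerWeight_eq_succ hγ
  have hfactor : monomial (β + Finsupp.single j 1 + Finsupp.single i 1) c
      = monomial β c * (X j * X i) := by
    simp only [X, monomial_mul, mul_one, add_assoc]
  simp only [map_add, Finsupp.weight_single, one_smul, add_assoc] at hαn
  have hβmem : monomial β c ∈ boundedOutside R w s (Finsupp.weight w β) r :=
    ⟨monomial_mem_weightLE le_rfl c, monomial_mem_weightLE hβ.le c⟩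
  exact hfactor ▸ mem_boundedOutside_sup_of_le hαn
    (mul_mem_boundedOutside_sup hβmem (hI j hj i hi))

/-- Products of two outer variables can be rewritten one at a time, each step lowering the outer
degree, until at most one outer variable is left. -/
theorem weightLE_le_boundedOutside_one_sup
    (hI : ∀ i ∉ s, ∀ j ∉ s,
      X i * X j ∈ boundedOutside R w s (w i + w j) 1 ⊔ I.restrictScalars R) (n : ℕ) :
    weightLE R w n ≤ boundedOutside R w s n 1 ⊔ I.restrictScalars R := by
  have hle (r : ℕ) : boundedOutside R w s n (r + 1)
      ≤ boundedOutside R w s n 1 ⊔ I.restrictScalars R := by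
    induction r with
    | zero => exact le_sup_left
    | succ r ih => exact (boundedOutside_add_two_le_sup hI n r).trans (sup_le ih le_sup_right)
  intro p hp
  obtain ⟨r, hr⟩ := exists_mem_weightLE (outerWeight s) p
  exact hle r ⟨hp, weightLE_mono _ r.le_succ hr⟩

end BoundedOutside

section QuadraticPart

open MvPolynomial

variable {σ R : Type*} [CommSemiring R]

theorem exists_mem_totalDegree_eq [IsDomain R] [Nonempty σ] {I : Ideal (MvPolynomial σ R)}
    {f : MvPolynomial σ R} (hf : f ∈ I) (hf₀ : f ≠ 0) {d : ℕ} (hd : f.totalDegree ≤ d) :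
    ∃ g ∈ I, g.totalDegree = d := by
  obtain ⟨i⟩ := ‹Nonempty σ›
  refine ⟨X i ^ (d - f.totalDegree) * f, I.mul_mem_left _ hf, ?_⟩
  rw [totalDegree_mul_of_isDomain (pow_ne_zero _ (X_ne_zero i)) hf₀, totalDegree_X_pow,
    Nat.sub_add_cancel hd]

theorem totalDegree_pderiv_le (i : σ) (f : MvPolynomial σ R) :
    (pderiv i f).totalDegree ≤ f.totalDegree - 1 := by
  refine Finset.sup_le fun α hα => ?_
  rw [mem_support_iff, coeff_pderiv] at hα
  have hdeg := le_totalDegree (mem_support_iff.2 (left_ne_zero_of_mul hα))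
  rw [Finsupp.sum_add_index' (by simp) (by simp), Finsupp.sum_single_index rfl] at hdeg
  omega

theorem mem_vars_of_coeff_single_ne_zero {g : MvPolynomial σ R} {i : σ}
    (h : coeff (Finsupp.single i 1) g ≠ 0) : i ∈ g.vars :=
  (mem_vars_iff_mem_support i).2 ⟨_, mem_support_iff.2 h, by simp⟩

theorem eq_C_add_sum_of_totalDegree_le_one {g : MvPolynomial σ R} (hg : g.totalDegree ≤ 1) :
    g = C (coeff 0 g) + ∑ l ∈ g.vars, coeff (Finsupp.single l 1) g • X l := by
  classical
  ext α
  simp only [coeff_add, coeff_C, coeff_sum, coeff_smul, coeff_X, smul_eq_mul, mul_ite, mul_one,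
    mul_zero]
  by_cases hα : α.degree ≤ 1
  · rcases eq_zero_or_single_of_degree_le_one hα with rfl | ⟨j, rfl⟩
    · simp
    · have hj : j ∉ g.vars → coeff (Finsupp.single j 1) g = 0 := fun hj =>
        by_contra fun h => hj (mem_vars_of_coeff_single_ne_zero h)
      simpa [Finsupp.single_left_inj, Ne.symm] using hj
  · have hne : α ≠ 0 ∧ ∀ j, Finsupp.single j 1 ≠ α :=
      ⟨by rintro rfl; simp at hα, by rintro j rfl; simp at hα⟩
    have hcoeff : coeff α g = 0 := coeff_eq_zero_of_totalDegree_lt (hg.trans_lt (not_le.1 hα))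
    simp [hne.1.symm, hne.2, hcoeff]

theorem derivation_eq_sum_pderiv (D : Derivation R (MvPolynomial σ R) (MvPolynomial σ R))
    (f : MvPolynomial σ R) : D f = ∑ i ∈ f.vars, pderiv i f * D (X i) := by
  classical
  have sum_apply (g : MvPolynomial σ R) : (∑ i ∈ f.vars, D (X i) • pderiv i :
      Derivation R (MvPolynomial σ R) (MvPolynomial σ R)) g
        = ∑ i ∈ f.vars, pderiv i g * D (X i) := by
    rw [← Derivation.coeFnAddMonoidHom_apply, map_sum, Finset.sum_apply]
    exact Finset.sum_congr rfl fun i _ => mul_comm _ _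
  rw [← sum_apply]
  refine derivation_eq_of_forall_mem_vars fun j hj => ?_
  simp [sum_apply, pderiv_X, Pi.single_apply, hj]

/-- The coefficients `∂ⱼ∂ᵢf` at the origin of the Hessian of `f`; they determine its quadratic
part outside characteristic two. -/
noncomputable def quadCoeff (f : MvPolynomial σ R) (i j : σ) : R :=
  coeff (Finsupp.single j 1) (pderiv i f)

theorem mem_vars_of_quadCoeff_ne_zero {f : MvPolynomial σ R} {i j : σ}
    (h : quadCoeff f i j ≠ 0) : i ∈ f.vars ∧ j ∈ f.vars := by
  rw [quadCoeff, coeff_pderiv] at h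
  have hsupp := mem_support_iff.2 (left_ne_zero_of_mul h)
  constructor <;> exact (mem_vars_iff_mem_support _).2 ⟨_, hsupp, by simp⟩

theorem exists_quadCoeff_ne_zero [NoZeroDivisors R] [CharZero R] {f : MvPolynomial σ R}
    (hf : f.totalDegree = 2) : ∃ i j, quadCoeff f i j ≠ 0 := by
  have hsupp : f.support.Nonempty := support_nonempty.2 (by rintro rfl; simp at hf)
  obtain ⟨α, hα, hdeg⟩ := f.support.exists_mem_eq_sup hsupp Finsupp.degree
  replace hdeg : α.degree = 2 := hdeg.symm.trans hf
  obtain ⟨i, hi⟩ := Finsupp.ne_iff.1 (show α ≠ 0 by rintro rfl; simp at hdeg)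
  have hadd := Finsupp.sub_add_single_one_cancel hi
  have hdeg₁ : (α - Finsupp.single i 1).degree = 1 := by
    have := congrArg Finsupp.degree hadd
    rw [map_add, Finsupp.degree_single, hdeg] at this
    exact Nat.succ_injective this
  obtain ⟨j, hj : Finsupp.single j 1 = _⟩ := Finsupp.range_single_one.ge hdeg₁
  refine ⟨i, j, ?_⟩
  rw [quadCoeff, coeff_pderiv, hj, hadd]
  exact mul_ne_zero (mem_support_iff.1 hα) (Nat.cast_add_one_ne_zero _)

theorem pderiv_mul_mem {f g : MvPolynomial σ R} (hf : f.totalDegree ≤ 2) {i : σ}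
    {M : Submodule R (MvPolynomial σ R)} (hg : g ∈ M)
    (hXg : ∀ j, quadCoeff f i j ≠ 0 → X j * g ∈ M) : pderiv i f * g ∈ M := by
  rw [eq_C_add_sum_of_totalDegree_le_one
    ((totalDegree_pderiv_le i f).trans (Nat.sub_le_sub_right hf 1)), add_mul, Finset.sum_mul]
  refine M.add_mem (C_mul' (R := R) ▸ M.smul_mem _ hg) (M.sum_mem fun j _ => ?_)
  rw [smul_mul_assoc]
  by_cases h : quadCoeff f i j = 0
  · rw [quadCoeff] at h
    simp [h]
  · exact M.smul_mem _ (hXg j h)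

theorem derivation_pderiv_of_totalDegree_le_two
    (D : Derivation R (MvPolynomial σ R) (MvPolynomial σ R)) {f : MvPolynomial σ R}
    (hf : f.totalDegree ≤ 2) (i : σ) :
    D (pderiv i f) = ∑ j ∈ (pderiv i f).vars, quadCoeff f i j • D (X j) := by
  conv_lhs => rw [eq_C_add_sum_of_totalDegree_le_one
    ((totalDegree_pderiv_le i f).trans (Nat.sub_le_sub_right hf 1))]
  simp only [map_add, derivation_C, zero_add, map_sum, Derivation.map_smul, quadCoeff]

theorem derivation_derivation_of_totalDegree_le_two
    (D E : Derivation R (MvPolynomial σ R) (MvPolynomial σ R)) {f : MvPolynomial σ R}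
    (hf : f.totalDegree ≤ 2) :
    D (E f) = ∑ i ∈ f.vars, pderiv i f * D (E (X i)) +
      ∑ p ∈ f.vars.sigma fun i => (pderiv i f).vars,
        quadCoeff f p.1 p.2 • (E (X p.1) * D (X p.2)) := by
  rw [derivation_eq_sum_pderiv E, map_sum, Finset.sum_sigma, ← Finset.sum_add_distrib]
  refine Finset.sum_congr rfl fun i _ => ?_
  rw [Derivation.leibniz, derivation_pderiv_of_totalDegree_le_two D hf, smul_eq_mul, smul_eq_mul,
    Finset.mul_sum]
  simp only [mul_smul_comm]

end QuadraticPart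

namespace PoissonStructure

variable {k A : Type*} [Field k] [CommRing A] [Algebra k A] {P : PoissonStructure k A}
  {F : ℕ → Submodule k A}

/-- An exhaustive increasing filtration for which both the product and the Poisson bracket have
degree zero. -/
structure IsFiltration (P : PoissonStructure k A) (F : ℕ → Submodule k A) : Prop where
  mono : Monotone F
  exhaustive : ∀ a, ∃ n, a ∈ F n
  one_mem : 1 ∈ F 0
  mul_mem : ∀ {m n a b}, a ∈ F m → b ∈ F n → a * b ∈ F (m + n)
  bracket_mem : ∀ {m n a b}, a ∈ F m → b ∈ F n → P.bracket a b ∈ F (m + n)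

namespace IsFiltration

theorem exists_le_of_finiteDimensional (hF : P.IsFiltration F) (V : Submodule k A)
    [hV : FiniteDimensional k V] : ∃ d, V ≤ F d := by
  obtain ⟨S, rfl⟩ := (Submodule.fg_iff_finiteDimensional V).2 hV
  choose level hlevel using hF.exhaustive
  exact ⟨S.sup level, Submodule.span_le.2 fun a ha => hF.mono (Finset.le_sup ha) (hlevel a)⟩

theorem bracePow_le (hF : P.IsFiltration F) {V : Submodule k A} {d : ℕ} (hV : V ≤ F d) (n : ℕ) :
    P.bracePow V n ≤ F (d * n) := by
  induction n with
  | zero => exact Submodule.one_le.2 hF.one_mem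
  | succ n ih =>
    rw [mul_add, mul_one, add_comm (d * n)]
    exact sup_le (Submodule.mul_le.2 fun a ha b hb => hF.mul_mem (hV ha) (ih hb))
      (Submodule.map₂_le.2 fun a ha b hb => hF.bracket_mem (hV ha) (ih hb))

theorem pd_le (hF : P.IsFiltration F) {e : ℕ}
    (hrank : ∀ n, Module.rank k (F n) ≤ ((n + 1) ^ e : ℕ)) {V : Submodule k A} {d : ℕ}
    (hV : V ≤ F d) (n : ℕ) : P.pd V n ≤ (d * n + 1) ^ e := by
  have hle : ⨆ i ∈ Finset.range (n + 1), P.bracePow V i ≤ F (d * n) := iSup₂_le fun i hi =>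
    (hF.bracePow_le hV i).trans
      (hF.mono (Nat.mul_le_mul_left d (Nat.lt_succ_iff.1 (Finset.mem_range.1 hi))))
  exact Module.finrank_le_of_rank_le ((Submodule.rank_mono hle).trans (hrank (d * n)))

theorem pgkDim_le (hF : P.IsFiltration F) {e : ℕ}
    (hrank : ∀ n, Module.rank k (F n) ≤ ((n + 1) ^ e : ℕ)) : P.pgkDim ≤ e := by
  refine iSup_le fun B => iSup_le fun V => iSup_le fun _ => iSup_le fun _ => ?_
  obtain ⟨d, hd⟩ := hF.exists_le_of_finiteDimensional V
  have hgrowth : GrowthLE (fun n => (P.pd V n : ℝ)) (fun n => (n : ℝ) ^ ((e : ℝ≥0) : ℝ)) := by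
    refine ⟨1, d + 1, Filter.eventually_atTop.2 ⟨1, fun n hn => ?_⟩⟩
    have hpd : P.pd V n ≤ ((d + 1) * n) ^ e :=
      (hF.pd_le hrank hd n).trans (Nat.pow_le_pow_left (by rw [add_mul, one_mul]; omega) e)
    simp only [NNReal.coe_natCast, Real.rpow_natCast, Nat.cast_one, one_mul]
    exact_mod_cast hpd
  exact (iInf₂_le (e : ℝ≥0) hgrowth).trans_eq (ENNReal.coe_natCast e)

theorem quotient (hF : P.IsFiltration F) {I : Ideal A} (hI : P.IsPoissonIdeal I) :
    (P.quotient I hI).IsFiltration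
      fun n => (F n).map (Ideal.Quotient.mkₐ k I).toLinearMap where
  mono _ _ hmn := Submodule.map_mono (hF.mono hmn)
  exhaustive a := by
    obtain ⟨a, rfl⟩ := Ideal.Quotient.mk_surjective a
    obtain ⟨n, hn⟩ := hF.exhaustive a
    exact ⟨n, a, hn, rfl⟩
  one_mem := ⟨1, hF.one_mem, map_one (Ideal.Quotient.mk I)⟩
  mul_mem := by
    rintro m n _ _ ⟨a, ha, rfl⟩ ⟨b, hb, rfl⟩
    exact ⟨a * b, hF.mul_mem ha hb, map_mul (Ideal.Quotient.mk I) a b⟩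
  bracket_mem := by
    rintro m n _ _ ⟨a, ha, rfl⟩ ⟨b, hb, rfl⟩
    exact ⟨P.bracket a b, hF.bracket_mem ha hb, rfl⟩

theorem pgkDim_quotient_le (hF : P.IsFiltration F) {I : Ideal A} (hI : P.IsPoissonIdeal I)
    {G : ℕ → Submodule k A} {e : ℕ} (hG : ∀ n, F n ≤ G n ⊔ I.restrictScalars k)
    (hrank : ∀ n, Module.rank k (G n) ≤ ((n + 1) ^ e : ℕ)) : (P.quotient I hI).pgkDim ≤ e := by
  refine (hF.quotient hI).pgkDim_le fun n => ?_
  have hker : I.restrictScalars k ≤ (Ideal.Quotient.mkₐ k I).toLinearMap.ker := fun a ha =>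
    Ideal.Quotient.eq_zero_iff_mem.2 ha
  have hmap : (F n).map (Ideal.Quotient.mkₐ k I).toLinearMap
      ≤ (G n).map (Ideal.Quotient.mkₐ k I).toLinearMap :=
    (LinearMap.map_le_map_iff _).2 ((hG n).trans (sup_le_sup_left hker _))
  exact (Submodule.rank_mono hmap).trans ((rank_map_le _ _).trans (hrank n))

end IsFiltration

end PoissonStructure

namespace SymWitt

open MvPolynomial

variable {k : Type*} [Field k]

/-- The grading weight of `x_i`, shifted by `C` so that a product of two variables has room for the
linear terms that appear when it is rewritten modulo an ideal. -/
def shiftedWeight (C : ℕ) (i : ℕ+) : ℕ := i + C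

theorem shiftedWeight_injective (C : ℕ) : Function.Injective (shiftedWeight C) := fun _ _ h =>
  PNat.coe_injective (Nat.add_right_cancel h)

theorem shiftedWeight_ne_zero (C : ℕ) (i : ℕ+) : shiftedWeight C i ≠ 0 :=
  (Nat.add_pos_left i.pos C).ne'

theorem adX_X (a i : ℕ+) : adX k a (X i) = (((i : ℕ) : k) - ((a : ℕ) : k)) • X (a + i) :=
  mkDerivation_X ..

theorem adX_X_mul_adX_X (a b i j : ℕ+) :
    adX k b (X i) * adX k a (X j) = ((((i : ℕ) : k) - ((b : ℕ) : k)) *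
      (((j : ℕ) : k) - ((a : ℕ) : k))) • (X (a + j) * X (b + i)) := by
  rw [adX_X, adX_X, smul_mul_smul_comm, mul_comm (X (b + i))]

theorem mul_adX_adX_X_mem {a b i : ℕ+} {M : Submodule k (SymWitt k)} {g : SymWitt k}
    (h : g * X (a + b + i) ∈ M) : g * adX k a (adX k b (X i)) ∈ M := by
  rw [adX_X, Derivation.map_smul, adX_X, smul_smul, mul_smul_comm, ← add_assoc]
  exact M.smul_mem _ h

theorem isFiltration_weightLE (C : ℕ) :
    (poisson k).IsFiltration (weightLE k (shiftedWeight C)) where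
  mono := weightLE_mono _
  exhaustive := exists_mem_weightLE _
  one_mem := monomial_mem_weightLE (map_zero _).le 1
  mul_mem := mul_mem_weightLE
  bracket_mem {m n p q} hp hq := by
    refine derivation_mem_weightLE (D := bracketRight k q) (fun i => ?_) hp
    rw [bracketRight, mkDerivation_X, add_comm]
    refine derivation_mem_weightLE (fun j => ?_) hq
    rw [adX_X]
    refine Submodule.smul_mem _ _ (X_mem_weightLE ?_)
    simp only [shiftedWeight, PNat.add_coe]
    omega

/-- `(i₀, j₀)` is the pair `(i, j)` with nonzero Hessian coefficient for which `i + j` is largest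
and, among these, `j` is largest. -/
def IsLeadingPair (f : SymWitt k) (i₀ j₀ : ℕ+) : Prop :=
  quadCoeff f i₀ j₀ ≠ 0 ∧
    ∀ i j, quadCoeff f i j ≠ 0 → toLex (i + j, j) ≤ toLex (i₀ + j₀, j₀)

theorem exists_isLeadingPair [CharZero k] {f : SymWitt k} (hf : f.totalDegree = 2) :
    ∃ i₀ j₀, IsLeadingPair f i₀ j₀ := by
  classical
  obtain ⟨i, j, hij⟩ := exists_quadCoeff_ne_zero hf
  let S := (f.vars ×ˢ f.vars).filter fun p => quadCoeff f p.1 p.2 ≠ 0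
  have mem_S {i j : ℕ+} (h : quadCoeff f i j ≠ 0) : (i, j) ∈ S :=
    Finset.mem_filter.2 ⟨Finset.mem_product.2 (mem_vars_of_quadCoeff_ne_zero h), h⟩
  obtain ⟨⟨i₀, j₀⟩, h₀, hmax⟩ :=
    S.exists_max_image (fun p => toLex (p.1 + p.2, p.2)) ⟨_, mem_S hij⟩
  exact ⟨i₀, j₀, (Finset.mem_filter.1 h₀).2, fun i j h => hmax (i, j) (mem_S h)⟩

theorem IsLeadingPair.toLex_lt {f : SymWitt k} {i₀ j₀ i j : ℕ+} (h₀ : IsLeadingPair f i₀ j₀)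
    (h : quadCoeff f i j ≠ 0) (hne : (i, j) ≠ (i₀, j₀)) (a b : ℕ+) :
    toLex (a + j + (b + i), a + j) < toLex (a + j₀ + (b + i₀), a + j₀) := by
  have hle := h₀.2 i j h
  simp only [Prod.Lex.toLex_le_toLex, Prod.Lex.toLex_lt_toLex, ne_eq, Prod.mk.injEq,
    ← PNat.coe_le_coe, ← PNat.coe_lt_coe, ← PNat.coe_inj, PNat.add_coe] at hle hne ⊢
  omega

/-- The double bracket `{x_a, {x_b, f}}` has leading term `x_{a + j₀} x_{b + i₀}`. -/
theorem IsLeadingPair.X_mul_X_mem [CharZero k] {f : SymWitt k} {i₀ j₀ a b : ℕ+}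
    (h₀ : IsLeadingPair f i₀ j₀) (hf : f.totalDegree ≤ 2) (ha : ∀ i ∈ f.vars, i < a)
    (hb : ∀ i ∈ f.vars, i < b) {M : Submodule k (SymWitt k)}
    (hfM : adX k a (adX k b f) ∈ M) (hlin : ∀ i ∈ f.vars, X (a + b + i) ∈ M)
    (hquad : ∀ u v, toLex (u + v, u) < toLex (a + j₀ + (b + i₀), a + j₀) → X u * X v ∈ M) :
    X (a + j₀) * X (b + i₀) ∈ M := by
  classical
  obtain ⟨hi₀, hj₀⟩ := mem_vars_of_quadCoeff_ne_zero h₀.1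
  have hmixed (i : ℕ+) (hi : i ∈ f.vars) : pderiv i f * adX k a (adX k b (X i)) ∈ M := by
    refine mul_adX_adX_X_mem (pderiv_mul_mem hf (hlin i hi) fun j hij => hquad _ _ ?_)
    have hle := h₀.2 i j hij
    have hja := ha j (mem_vars_of_quadCoeff_ne_zero hij).2
    simp only [Prod.Lex.toLex_le_toLex, Prod.Lex.toLex_lt_toLex,
      ← PNat.coe_lt_coe, ← PNat.coe_inj, PNat.add_coe] at hle hja ⊢
    omega
  have hother (i j : ℕ+) (hne : (i, j) ≠ (i₀, j₀)) :
      quadCoeff f i j • (adX k b (X i) * adX k a (X j)) ∈ M := by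
    by_cases hij : quadCoeff f i j = 0
    · rw [hij, zero_smul]
      exact M.zero_mem
    · rw [adX_X_mul_adX_X]
      exact M.smul_mem _ (M.smul_mem _ (hquad _ _ (h₀.toLex_lt hij hne a b)))
  have hlead : quadCoeff f i₀ j₀ • (adX k b (X i₀) * adX k a (X j₀)) ∈ M := by
    have hmem : (⟨i₀, j₀⟩ : Σ _ : ℕ+, ℕ+) ∈ f.vars.sigma fun i => (pderiv i f).vars :=
      Finset.mem_sigma.2 ⟨hi₀, mem_vars_of_coeff_single_ne_zero h₀.1⟩
    rw [derivation_derivation_of_totalDegree_le_two _ _ hf,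
      Submodule.add_mem_iff_right M (M.sum_mem hmixed), ← Finset.add_sum_erase _ _ hmem] at hfM
    refine (Submodule.add_mem_iff_left M (M.sum_mem fun ⟨i, j⟩ hij => hother i j ?_)).1 hfM
    rintro ⟨⟩
    exact Finset.notMem_erase _ _ hij
  have hcoeff : (((i₀ : ℕ) : k) - ((b : ℕ) : k)) * (((j₀ : ℕ) : k) - ((a : ℕ) : k)) ≠ 0 := by
    refine mul_ne_zero ?_ ?_ <;>
      rw [sub_ne_zero, Nat.cast_injective.ne_iff, PNat.coe_injective.ne_iff]
    · exact (hb i₀ hi₀).ne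
    · exact (ha j₀ hj₀).ne
  rwa [adX_X_mul_adX_X, M.smul_mem_iff h₀.1, M.smul_mem_iff hcoeff] at hlead

theorem IsLeadingPair.X_mul_X_mem_boundedOutside_sup [CharZero k] {J : Ideal (SymWitt k)}
    (hJ : (poisson k).IsPoissonIdeal J) {f : SymWitt k} (hfJ : f ∈ J) (hf : f.totalDegree ≤ 2)
    {i₀ j₀ m : ℕ+} (h₀ : IsLeadingPair f i₀ j₀) (hm : ∀ i ∈ f.vars, i ≤ m) (s t : ℕ+) :
    X s * X t ∈ boundedOutside k (shiftedWeight m) (Finset.Iic (m + m))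
      (shiftedWeight m s + shiftedWeight m t) 1 ⊔ J.restrictScalars k := by
  induction hst : toLex (s + t, s) using WellFoundedLT.induction generalizing s t with
  | ind x ih =>
  subst hst
  by_cases hinner : s ∈ Finset.Iic (m + m) ∨ t ∈ Finset.Iic (m + m)
  · exact Submodule.mem_sup_left (X_mul_X_mem_boundedOutside_one (shiftedWeight m) hinner)
  simp only [Finset.mem_Iic, not_or, not_le] at hinner
  obtain ⟨hs, ht⟩ := hinner
  obtain ⟨hi₀, hj₀⟩ := mem_vars_of_quadCoeff_ne_zero h₀.1
  have hmm : m < m + m := PNat.lt_add_left m m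
  obtain ⟨a, rfl⟩ : ∃ a, s = a + j₀ :=
    ⟨s - j₀, (PNat.sub_add_of_lt ((hm j₀ hj₀).trans_lt (hmm.trans hs))).symm⟩
  obtain ⟨b, rfl⟩ : ∃ b, t = b + i₀ :=
    ⟨t - i₀, (PNat.sub_add_of_lt ((hm i₀ hi₀).trans_lt (hmm.trans ht))).symm⟩
  have hma : m < a := lt_of_add_lt_add_right (hs.trans_le (add_le_add_right (hm j₀ hj₀) a))
  have hmb : m < b := lt_of_add_lt_add_right (ht.trans_le (add_le_add_right (hm i₀ hi₀) b))
  have hbracket : adX k a (adX k b f) ∈ J := by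
    simpa only [poisson, bracket_X_left] using hJ (X a) _ (hJ (X b) f hfJ)
  refine h₀.X_mul_X_mem hf (fun i hi => (hm i hi).trans_lt hma)
    (fun i hi => (hm i hi).trans_lt hmb) (Submodule.mem_sup_right hbracket)
    (fun i hi => Submodule.mem_sup_left ?_) fun u v huv => ?_
  · refine boundedOutside_mono _ _ ?_ le_rfl (X_mem_boundedOutside_one _ _ _)
    have him : (i : ℕ) ≤ m := hm i hi
    simp only [shiftedWeight, PNat.add_coe]
    omega
  · refine mem_boundedOutside_sup_of_le ?_ (ih _ huv u v rfl)
    have huv_le : u + v ≤ a + j₀ + (b + i₀) := Prod.Lex.monotone_fst _ _ huv.le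
    rw [← PNat.coe_le_coe] at huv_le
    simp only [shiftedWeight, PNat.add_coe] at huv_le ⊢
    omega

end SymWitt

theorem proposition4p8 {k : Type*} [Field k] [CharZero k] (J : Ideal (SymWitt k))
    (hJ : (SymWitt.poisson k).IsPoissonIdeal J)
    (h : ∃ f ∈ J, f ≠ 0 ∧ SymWitt.order f ≤ 2) :
    ((SymWitt.poisson k).quotient J hJ).pgkDim < ⊤ := by
  obtain ⟨f₀, hf₀J, hf₀, hle⟩ := h
  obtain ⟨f, hfJ, hf⟩ := exists_mem_totalDegree_eq hf₀J hf₀ hle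
  obtain ⟨i₀, j₀, hlead⟩ := SymWitt.exists_isLeadingPair hf
  obtain ⟨m, hm⟩ := f.vars.exists_le
  have hred := hlead.X_mul_X_mem_boundedOutside_sup hJ hfJ hf.le hm
  exact ((SymWitt.isFiltration_weightLE (m : ℕ)).pgkDim_quotient_le hJ
    (weightLE_le_boundedOutside_one_sup fun s _ t _ => hred s t)
    (rank_boundedOutside_one_le k (SymWitt.shiftedWeight_injective m)
      (SymWitt.shiftedWeight_ne_zero m) _)).trans_lt (ENNReal.natCast_lt_top _)
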